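/- Let $d\in\mathbb N$ and let $G(t,x)=(2\pi t)^{-d/2}e^{-|x|^2/(2t)}$ be the heat kernel on $\mathbb R^d$. For every $\theta>0$, $\kappa\in\mathbb R$ and $F\ge 0$ there is a constant $C=C(d,\kappa,\theta,F)>0$ such that the following holds. Let $f:\mathbb R\to\mathbb R$ be continuous with $|f(0)|\le F$ and $$f(u_2)-f(u_1)\le \kappa(u_2-u_1)\qquad\text{for all } u_1<u_2,$$ let $T>0$, and let $z:[0,T]\times\mathbb R^d\to\mathbb R$ be bounded and continuous. Then the integral equation $$u(t,x)=\int_0^t\int_{\mathbb R^d}G(t-s,x-y)\,f(u(s,y))\,dy\,ds+z(t,x),\qquad (t,x)\in[0,T]\times\mathbb R^d,$$ has exactly one bounded continuous solution $u=:\mathcal M(z)$, and for every $x_0\in\mathbb R^d$ $$\sup_{t\in[0,T]}\sup_{x\in\mathbb R^d}\frac{|\mathcal M(z)(t,x)|}{1+|x-x_0|^\theta}\le Ce^{CT}\left(1+\sup_{t\in[0,T]}\sup_{x\in\mathbb R^d}\frac{|z(t,x)|}{1+|x-x_0|^\theta}\right).$$ In particular $C$ does not depend on $T$, $z$ or $x_0$.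 -/

import Mathlib

/-- `Cb T d` is the space of bounded continuous functions `[0,T] × ℝ^d → ℝ`. -/
abbrev Cb (T : ℝ) (d : ℕ) : Type :=
  BoundedContinuousFunction (Set.Icc (0 : ℝ) T × EuclideanSpace ℝ (Fin d)) ℝ

/-- The heat kernel `G(t,x) = (2πt)^(-d/2) exp(-|x|²/(2t))` on `ℝ^d`, the fundamental solution
of `∂u/∂t = (1/2) Δu`. -/
noncomputable def heatKernel {d : ℕ} (t : ℝ) (x : EuclideanSpace ℝ (Fin d)) : ℝ :=
  (2 * Real.pi * t) ^ (-(d : ℝ) / 2) * Real.exp (-‖x‖ ^ 2 / (2 * t))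

/-- `u = 𝓜(z)`, i.e. `u` is a bounded continuous solution of the integral equation
`u(t,x) = ∫₀ᵗ ∫ G(t-s,x-y) f(u(s,y)) dy ds + z(t,x)` for `t ∈ [0,T]`, `x ∈ ℝ^d`.
The projection `Set.projIcc` only re-types `s ∈ [0,t] ⊆ [0,T]` as an element of `[0,T]`. -/
def SolvesMildEq (f : ℝ → ℝ) {T : ℝ} {d : ℕ} (z u : Cb T d) : Prop :=
  ∀ (t : Set.Icc (0 : ℝ) T) (x : EuclideanSpace ℝ (Fin d)),
    u (t, x) =
      (∫ s in (0 : ℝ)..(t : ℝ), ∫ y : EuclideanSpace ℝ (Fin d),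
        heatKernel ((t : ℝ) - s) (x - y) *
          f (u (Set.projIcc 0 T (t.2.1.trans t.2.2) s, y))) + z (t, x)

/-- The weighted supremum norm with weight exponent `θ` centered at `x₀`:
`sup_{t ∈ [0,T]} sup_{x ∈ ℝ^d} |u(t,x)| / (1 + |x - x₀|^θ)`.
The suprema are finite because `u` is bounded. -/
noncomputable def weightedSupNorm (θ : ℝ) {T : ℝ} {d : ℕ} (x₀ : EuclideanSpace ℝ (Fin d))
    (u : Cb T d) : ℝ :=
  ⨆ t : Set.Icc (0 : ℝ) T, ⨆ x : EuclideanSpace ℝ (Fin d), |u (t, x)| / (1 + ‖x - x₀‖ ^ θ)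

open MeasureTheory ProbabilityTheory Set Filter Topology

/-! Everything rests on a maximum principle for the heat potential $v=u-z=\int_0^tP_{t-s}g(s)\,ds$,
$g=f(u)$. Since $v$ need not be differentiable, it is argued in mild form (`duhamel_lt_barrier`).
Let $\rho=1+|x-x_0|^\theta$ and suppose $g<lv$ wherever $v\ge m\rho$. The barrier
$W=2me^{lt}P_t\rho$ dominates $m\rho$, so a bounded $v$ can meet it only in a compact set. At a
first contact, restarting $v$ slightly earlier (`duhamel_add`) contradicts $g<lv$.

The one-sided bound on $f$ supplies this hypothesis twice: for $u-z$, which gives the weighted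
estimate (`SolvesMildEq.abs_le_polyWeight`), and for the difference of two solutions with nearby
nonlinearities (`SolvesMildEq.abs_sub_le_of_near`), which gives uniqueness.

Existence: Picard iteration for Lipschitz $f$; uniform approximation by Lipschitz functions and
stability for $f$ composed with the projection onto $[-R,R]$; finally the a priori bound,
independent of $R$, shows that the truncation is never active. -/

/-! ### The heat semigroup as a Gaussian average. -/

lemma charFun_withDensity_heatKernel_one {d : ℕ} (w : EuclideanSpace ℝ (Fin d)) :
    charFun (volume.withDensity fun x : EuclideanSpace ℝ (Fin d) =>
      ENNReal.ofReal (heatKernel 1 x)) w = Complex.exp (-‖w‖ ^ 2 / 2) := by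
  have hnn : ∀ x : EuclideanSpace ℝ (Fin d), 0 ≤ heatKernel 1 x := fun x => by
    unfold heatKernel; positivity
  have hm : Measurable fun x : EuclideanSpace ℝ (Fin d) => ENNReal.ofReal (heatKernel 1 x) := by
    unfold heatKernel; fun_prop
  rw [charFun_apply, integral_withDensity_eq_integral_toReal_smul hm (by simp)]
  have h := GaussianFourier.integral_cexp_neg_mul_sq_norm_add (V := EuclideanSpace ℝ (Fin d))
    (b := 1 / 2) (by norm_num) Complex.I w
  have e : ∀ x : EuclideanSpace ℝ (Fin d),
      (ENNReal.ofReal (heatKernel 1 x)).toReal • Complex.exp (inner ℝ x w * Complex.I) =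
      (((2 * Real.pi) ^ (-(d : ℝ) / 2) : ℝ) : ℂ) *
        Complex.exp (-(1 / 2) * ‖x‖ ^ 2 + Complex.I * inner ℝ w x) := fun x => by
    rw [ENNReal.toReal_ofReal (hnn x), heatKernel, Complex.real_smul, Complex.exp_add,
      real_inner_comm]
    push_cast
    rw [mul_assoc]
    congr 3
    · simp
    · ring
    · ring_nf
  simp_rw [e]
  rw [integral_const_mul, h, finrank_euclideanSpace_fin, ← mul_assoc]
  have : (((2 * Real.pi) ^ (-(d : ℝ) / 2) : ℝ) : ℂ) *
      ((Real.pi : ℂ) / (1 / 2)) ^ ((d : ℂ) / 2) = 1 := by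
    have h2 : ((Real.pi : ℂ) / (1 / 2)) ^ ((d : ℂ) / 2)
        = (((2 * Real.pi) ^ ((d : ℝ) / 2) : ℝ) : ℂ) := by
      rw [Complex.ofReal_cpow (by positivity)]
      push_cast
      congr 1
      ring
    rw [h2, ← Complex.ofReal_mul, ← Real.rpow_add (by positivity)]
    simp [neg_div]
  rw [this, one_mul]
  congr 1
  simp
  ring

lemma stdGaussian_eq_withDensity_heatKernel (d : ℕ) :
    stdGaussian (EuclideanSpace ℝ (Fin d)) =
      volume.withDensity fun x => ENNReal.ofReal (heatKernel 1 x) := by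
  have hm : Measurable fun x : EuclideanSpace ℝ (Fin d) => ENNReal.ofReal (heatKernel 1 x) := by
    unfold heatKernel; fun_prop
  have hint : Integrable fun x : EuclideanSpace ℝ (Fin d) => heatKernel 1 x := by
    have h := GaussianFourier.integrable_cexp_neg_mul_sq_norm_add
      (V := EuclideanSpace ℝ (Fin d)) (b := 1 / 2) (by norm_num) 0 0
    have h' := (h.re).const_mul ((2 * Real.pi * 1) ^ (-(d : ℝ) / 2))
    refine h'.congr (Eventually.of_forall fun x => ?_)
    have : (-(1 / 2) * (‖x‖ : ℂ) ^ 2 + 0 * inner ℝ 0 x) = ((-‖x‖ ^ 2 / (2 * 1) : ℝ) : ℂ) := by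
      push_cast; ring
    simp only [heatKernel, this, ← Complex.ofReal_exp, RCLike.re_eq_complex_re, Complex.ofReal_re]
  have : IsFiniteMeasure (volume.withDensity fun x : EuclideanSpace ℝ (Fin d) =>
      ENNReal.ofReal (heatKernel 1 x)) := isFiniteMeasure_withDensity_ofReal hint.2
  refine Measure.ext_of_charFun (funext fun w => ?_)
  rw [charFun_stdGaussian, charFun_withDensity_heatKernel_one]

/-- The heat semigroup, written as a Gaussian average. -/
noncomputable def heatSemigroup {d : ℕ} (t : ℝ) (ψ : EuclideanSpace ℝ (Fin d) → ℝ)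
    (x : EuclideanSpace ℝ (Fin d)) : ℝ :=
  ∫ η, ψ (x + √t • η) ∂stdGaussian (EuclideanSpace ℝ (Fin d))

/-- Translate by $x$ and substitute $y=\sqrt t\,\eta$; the Jacobian cancels the power of $t$ in the
kernel. Unlike the kernel, the Gaussian form is regular at $t=0$, where it is the identity. -/
lemma integral_heatKernel_mul {d : ℕ} {t : ℝ} (ht : 0 < t) (ψ : EuclideanSpace ℝ (Fin d) → ℝ)
    (x : EuclideanSpace ℝ (Fin d)) :
    ∫ y, heatKernel t (x - y) * ψ y = heatSemigroup t ψ x := by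
  have hnn : ∀ x : EuclideanSpace ℝ (Fin d), 0 ≤ heatKernel 1 x := fun x => by
    unfold heatKernel; positivity
  have hm : Measurable fun x : EuclideanSpace ℝ (Fin d) => ENNReal.ofReal (heatKernel 1 x) := by
    unfold heatKernel; fun_prop
  have hs : 0 < √t := Real.sqrt_pos.2 ht
  rw [heatSemigroup, stdGaussian_eq_withDensity_heatKernel,
    integral_withDensity_eq_integral_toReal_smul hm (by simp)]
  have h1 : ∫ y, heatKernel t (x - y) * ψ y = ∫ y, heatKernel t y * ψ (x + y) := by
    rw [← integral_add_left_eq_self (fun y => heatKernel t (x - y) * ψ y) x]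
    refine integral_congr_ae (Eventually.of_forall fun y => ?_)
    simp [heatKernel]
  have h2 := Measure.integral_comp_smul (μ := (volume : Measure (EuclideanSpace ℝ (Fin d))))
    (fun y => heatKernel t y * ψ (x + y)) (√t)
  have h3 : ∫ y, heatKernel t y * ψ (x + y) =
      √t ^ d * ∫ y, heatKernel t (√t • y) * ψ (x + √t • y) := by
    rw [h2, finrank_euclideanSpace_fin, abs_of_pos (by positivity), smul_eq_mul, ← mul_assoc,
      mul_inv_cancel₀ (by positivity), one_mul]
  rw [h1, h3, ← integral_const_mul]
  refine integral_congr_ae (Eventually.of_forall fun y => ?_)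
  simp only [smul_eq_mul, ENNReal.toReal_ofReal (hnn y)]
  rw [← mul_assoc]
  congr 1
  rw [heatKernel, heatKernel, ← mul_assoc]
  congr 1
  · rw [Real.mul_rpow (by positivity) ht.le, mul_one, Real.sqrt_eq_rpow, ← Real.rpow_natCast,
      ← Real.rpow_mul ht.le, mul_comm, mul_assoc, ← Real.rpow_add ht]
    have : -(d : ℝ) / 2 + 1 / 2 * d = 0 := by ring
    rw [this]; simp
  · rw [norm_smul, Real.norm_of_nonneg hs.le, mul_pow, Real.sq_sqrt ht.le]
    congr 1
    field_simp

/-- Characteristic functions multiply, so variances add; this is the semigroup law. -/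
lemma stdGaussian_conv_scale {d : ℕ} {a b : ℝ} (ha : 0 ≤ a) (hb : 0 ≤ b) :
    ((stdGaussian (EuclideanSpace ℝ (Fin d))).map (√a • ·)).conv
      ((stdGaussian (EuclideanSpace ℝ (Fin d))).map (√b • ·)) =
      (stdGaussian (EuclideanSpace ℝ (Fin d))).map (√(a + b) • ·) := by
  have : ∀ r : ℝ, IsProbabilityMeasure
      ((stdGaussian (EuclideanSpace ℝ (Fin d))).map (r • ·)) := fun r =>
    Measure.isProbabilityMeasure_map (by fun_prop)
  refine Measure.ext_of_charFun (funext fun w => ?_)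
  rw [charFun_conv, charFun_map_smul, charFun_map_smul, charFun_map_smul, charFun_stdGaussian,
    charFun_stdGaussian, charFun_stdGaussian, ← Complex.exp_add]
  congr 1
  have key : ∀ r : ℝ, 0 ≤ r → (‖√r • w‖ : ℂ) ^ 2 = r * (‖w‖ : ℂ) ^ 2 := fun r hr => by
    rw [norm_smul, Real.norm_of_nonneg (Real.sqrt_nonneg r), Complex.ofReal_mul, mul_pow,
      ← Complex.ofReal_pow √r, Real.sq_sqrt hr]
  rw [key a ha, key b hb, key _ (add_nonneg ha hb)]
  push_cast
  ring

lemma heatSemigroup_add {d : ℕ} {a b : ℝ} (ha : 0 ≤ a) (hb : 0 ≤ b)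
    {ψ : EuclideanSpace ℝ (Fin d) → ℝ} (hψ : Continuous ψ) (x : EuclideanSpace ℝ (Fin d))
    (hint : Integrable (fun η => ψ (x + √(a + b) • η)) (stdGaussian (EuclideanSpace ℝ (Fin d)))) :
    heatSemigroup a (heatSemigroup b ψ) x = heatSemigroup (a + b) ψ x := by
  set γ := stdGaussian (EuclideanSpace ℝ (Fin d)) with hγ
  have : ∀ r : ℝ, IsProbabilityMeasure (γ.map (r • ·)) := fun r =>
    Measure.isProbabilityMeasure_map (by fun_prop)
  have hc := stdGaussian_conv_scale (d := d) ha hb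
  have hmeas : ∀ μ : Measure (EuclideanSpace ℝ (Fin d)),
      AEStronglyMeasurable (fun y => ψ (x + y)) μ := fun μ =>
    (hψ.comp (continuous_const.add continuous_id)).aestronglyMeasurable
  have h1 : Integrable (fun y => ψ (x + y)) ((γ.map (√a • ·)).conv (γ.map (√b • ·))) := by
    rw [hc, integrable_map_measure (hmeas _) (by fun_prop)]
    exact hint
  have h2 : ∫ y, ψ (x + y) ∂((γ.map (√a • ·)).conv (γ.map (√b • ·))) =
      heatSemigroup (a + b) ψ x := by
    rw [hc, integral_map (by fun_prop) (hmeas _), heatSemigroup]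
  rw [← h2, integral_conv h1]
  simp only [heatSemigroup]
  rw [integral_map (by fun_prop)]
  · refine integral_congr_ae (Eventually.of_forall fun y => ?_)
    simp only
    rw [integral_map (by fun_prop)]
    · simp only [add_assoc]; rfl
    · exact (hψ.comp (by fun_prop)).aestronglyMeasurable
  · have : StronglyMeasurable fun y => ∫ y', ψ (x + (y + y')) ∂(γ.map (√b • ·)) := by
      refine StronglyMeasurable.integral_prod_right (f := fun y y' => ψ (x + (y + y'))) ?_
      exact (hψ.comp (by fun_prop)).stronglyMeasurable
    exact this.aestronglyMeasurable

/-- `√` is continuous on all of $\mathbb R$ and zero on negatives, so no sign condition on time is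
needed. -/
lemma continuous_heatSemigroup {d : ℕ} {g : ℝ → EuclideanSpace ℝ (Fin d) → ℝ}
    (hg : Continuous (Function.uncurry g)) {B : ℝ} (hB : ∀ s x, |g s x| ≤ B) :
    Continuous fun p : ℝ × ℝ × EuclideanSpace ℝ (Fin d) => heatSemigroup p.1 (g p.2.1) p.2.2 := by
  unfold heatSemigroup
  refine continuous_of_dominated (bound := fun _ => B) (fun p => ?_) (fun p => ?_)
    (integrable_const _) ?_
  · exact (hg.comp (f := fun η => (p.2.1, p.2.2 + √p.1 • η)) (by fun_prop)).aestronglyMeasurable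
  · exact Eventually.of_forall fun η => hB _ _
  · refine Eventually.of_forall fun η => ?_
    exact hg.comp (f := fun p : ℝ × ℝ × EuclideanSpace ℝ (Fin d) => (p.2.1, p.2.2 + √p.1 • η))
      (by fun_prop)

lemma abs_heatSemigroup_le {d : ℕ} {ψ : EuclideanSpace ℝ (Fin d) → ℝ} {B : ℝ}
    (hB : ∀ x, |ψ x| ≤ B) (t : ℝ) (x : EuclideanSpace ℝ (Fin d)) :
    |heatSemigroup t ψ x| ≤ B := by
  have := norm_integral_le_of_norm_le_const (μ := stdGaussian (EuclideanSpace ℝ (Fin d)))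
    (f := fun η => ψ (x + √t • η)) (C := B) (Eventually.of_forall fun η => hB _)
  simpa [heatSemigroup] using this

lemma heatSemigroup_zero {d : ℕ} (ψ : EuclideanSpace ℝ (Fin d) → ℝ)
    (x : EuclideanSpace ℝ (Fin d)) : heatSemigroup 0 ψ x = ψ x := by
  simp [heatSemigroup]

/-! ### Heat potentials. -/

/-- The space-time heat potential `∫₀ᵗ P_{t-s} g(s) ds` of a source `g`. -/
noncomputable def duhamel {d : ℕ} (g : ℝ → EuclideanSpace ℝ (Fin d) → ℝ) (t : ℝ)
    (x : EuclideanSpace ℝ (Fin d)) : ℝ :=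
  ∫ s in (0 : ℝ)..t, heatSemigroup (t - s) (g s) x

lemma continuous_heatSemigroup_sub {d : ℕ} {g : ℝ → EuclideanSpace ℝ (Fin d) → ℝ}
    (hg : Continuous (Function.uncurry g)) {B : ℝ} (hB : ∀ s x, |g s x| ≤ B) (t : ℝ)
    (x : EuclideanSpace ℝ (Fin d)) : Continuous fun s => heatSemigroup (t - s) (g s) x :=
  (continuous_heatSemigroup hg hB).comp (f := fun s => (t - s, s, x)) (by fun_prop)

lemma continuous_duhamel {d : ℕ} {g : ℝ → EuclideanSpace ℝ (Fin d) → ℝ}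
    (hg : Continuous (Function.uncurry g)) {B : ℝ} (hB : ∀ s x, |g s x| ≤ B) :
    Continuous (Function.uncurry (duhamel g)) := by
  refine intervalIntegral.continuous_parametric_intervalIntegral_of_continuous
    (f := fun (p : ℝ × EuclideanSpace ℝ (Fin d)) s => heatSemigroup (p.1 - s) (g s) p.2)
    ?_ continuous_fst
  exact (continuous_heatSemigroup hg hB).comp
    (f := fun q : (ℝ × EuclideanSpace ℝ (Fin d)) × ℝ => (q.1.1 - q.2, q.2, q.1.2)) (by fun_prop)

lemma heatSemigroup_sub {d : ℕ} {ψ φ : EuclideanSpace ℝ (Fin d) → ℝ} {B B' : ℝ}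
    (hψ : Continuous ψ) (hφ : Continuous φ) (hB : ∀ x, |ψ x| ≤ B) (hB' : ∀ x, |φ x| ≤ B')
    (t : ℝ) (x : EuclideanSpace ℝ (Fin d)) :
    heatSemigroup t (fun y => ψ y - φ y) x = heatSemigroup t ψ x - heatSemigroup t φ x := by
  refine integral_sub ?_ ?_
  · exact Integrable.of_bound (hψ.comp (by fun_prop)).aestronglyMeasurable B
      (Eventually.of_forall fun η => hB _)
  · exact Integrable.of_bound (hφ.comp (by fun_prop)).aestronglyMeasurable B'
      (Eventually.of_forall fun η => hB' _)

lemma duhamel_sub {d : ℕ} {g k : ℝ → EuclideanSpace ℝ (Fin d) → ℝ} {B B' : ℝ}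
    (hg : Continuous (Function.uncurry g)) (hk : Continuous (Function.uncurry k))
    (hB : ∀ s x, |g s x| ≤ B) (hB' : ∀ s x, |k s x| ≤ B') (t : ℝ)
    (x : EuclideanSpace ℝ (Fin d)) :
    duhamel (fun s y => g s y - k s y) t x = duhamel g t x - duhamel k t x := by
  rw [duhamel, duhamel, duhamel, ← intervalIntegral.integral_sub]
  · refine intervalIntegral.integral_congr fun s _ => ?_
    exact heatSemigroup_sub (hg.uncurry_left s) (hk.uncurry_left s) (hB s) (hB' s) _ _
  · exact (continuous_heatSemigroup_sub hg hB t x).intervalIntegrable _ _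
  · exact (continuous_heatSemigroup_sub hk hB' t x).intervalIntegrable _ _

lemma duhamel_neg {d : ℕ} (g : ℝ → EuclideanSpace ℝ (Fin d) → ℝ) (t : ℝ)
    (x : EuclideanSpace ℝ (Fin d)) : duhamel (fun s y => -g s y) t x = -duhamel g t x := by
  simp [duhamel, heatSemigroup, integral_neg, intervalIntegral.integral_neg]

lemma abs_duhamel_le {d : ℕ} {g : ℝ → EuclideanSpace ℝ (Fin d) → ℝ} {b : ℝ → ℝ} {t : ℝ}
    (ht : 0 ≤ t) (hb : Continuous b) (hgb : ∀ s ∈ Icc 0 t, ∀ x, |g s x| ≤ b s)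
    (x : EuclideanSpace ℝ (Fin d)) : |duhamel g t x| ≤ ∫ s in (0 : ℝ)..t, b s := by
  refine intervalIntegral.norm_integral_le_of_norm_le (μ := volume)
    (f := fun s => heatSemigroup (t - s) (g s) x) ht
    (Eventually.of_forall fun s hs => ?_) (hb.intervalIntegrable _ _)
  exact abs_heatSemigroup_le (hgb s ⟨hs.1.le, hs.2⟩) _ _

/-- Restarting the heat potential at time `t`. -/
lemma duhamel_add {d : ℕ} {g : ℝ → EuclideanSpace ℝ (Fin d) → ℝ}
    (hg : Continuous (Function.uncurry g)) {B : ℝ} (hB : ∀ s x, |g s x| ≤ B) {t h : ℝ}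
    (ht : 0 ≤ t) (hh : 0 ≤ h) (x : EuclideanSpace ℝ (Fin d)) :
    duhamel g (t + h) x =
      heatSemigroup h (duhamel g t) x +
        ∫ s in t..(t + h), heatSemigroup (t + h - s) (g s) x := by
  have hc := continuous_heatSemigroup_sub hg hB (t + h) x
  rw [duhamel, ← intervalIntegral.integral_add_adjacent_intervals
    (hc.intervalIntegrable 0 t) (hc.intervalIntegrable t (t + h))]
  congr 1
  have h1 : ∀ s ∈ Icc 0 t, heatSemigroup (t + h - s) (g s) x =
      heatSemigroup h (fun y => heatSemigroup (t - s) (g s) y) x := fun s hs => by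
    have hcs : Continuous (g s) := hg.uncurry_left s
    rw [show t + h - s = h + (t - s) by ring]
    refine (heatSemigroup_add hh (sub_nonneg.2 hs.2) hcs x ?_).symm
    exact Integrable.of_bound (hcs.comp (by fun_prop)).aestronglyMeasurable B
      (Eventually.of_forall fun η => hB _ _)
  rw [intervalIntegral.integral_congr (fun s hs => h1 s (by rwa [uIcc_of_le ht] at hs))]
  simp only [heatSemigroup.eq_1 h]
  simp only [duhamel, intervalIntegral.integral_of_le ht]
  refine integral_integral_swap
    (f := fun s η => heatSemigroup (t - s) (g s) (x + √h • η)) ?_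
  refine Integrable.of_bound ?_ B (Eventually.of_forall fun p => abs_heatSemigroup_le (hB _) _ _)
  refine Continuous.aestronglyMeasurable ?_
  exact (continuous_heatSemigroup hg hB).comp
    (f := fun q : ℝ × EuclideanSpace ℝ (Fin d) => (t - q.1, q.1, x + √h • q.2)) (by fun_prop)

/-! ### Two-sided bounds for the heat flow of the polynomial weight. -/

/-- The polynomial weight `1 + |x - x₀|^θ`. -/
noncomputable def polyWeight {d : ℕ} (θ : ℝ) (x₀ x : EuclideanSpace ℝ (Fin d)) : ℝ :=
  1 + ‖x - x₀‖ ^ θ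

/-- The absolute moment of order `θ` of the standard Gaussian measure. -/
noncomputable def gaussianMoment (d : ℕ) (θ : ℝ) : ℝ :=
  ∫ η, ‖η‖ ^ θ ∂stdGaussian (EuclideanSpace ℝ (Fin d))

lemma one_le_polyWeight {d : ℕ} (θ : ℝ) (x₀ x : EuclideanSpace ℝ (Fin d)) :
    1 ≤ polyWeight θ x₀ x := by
  have : 0 ≤ ‖x - x₀‖ ^ θ := by positivity
  unfold polyWeight; linarith

lemma gaussianMoment_nonneg (d : ℕ) (θ : ℝ) : 0 ≤ gaussianMoment d θ :=
  integral_nonneg fun η => by positivity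

lemma continuous_polyWeight {d : ℕ} {θ : ℝ} (hθ : 0 < θ) (x₀ : EuclideanSpace ℝ (Fin d)) :
    Continuous (polyWeight θ x₀) := by
  unfold polyWeight
  exact continuous_const.add ((by fun_prop : Continuous fun x => ‖x - x₀‖).rpow_const
    fun _ => Or.inr hθ.le)

lemma integrable_norm_rpow_stdGaussian {d : ℕ} {θ : ℝ} (hθ : 0 < θ) :
    Integrable (fun η => ‖η‖ ^ θ) (stdGaussian (EuclideanSpace ℝ (Fin d))) := by
  have h := IsGaussian.memLp_id (stdGaussian (EuclideanSpace ℝ (Fin d))) (ENNReal.ofReal θ)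
    ENNReal.ofReal_ne_top
  have := h.integrable_norm_rpow (by simpa using hθ) ENNReal.ofReal_ne_top
  simpa [ENNReal.toReal_ofReal hθ.le] using this

lemma add_rpow_le_two_rpow_mul {a b θ : ℝ} (ha : 0 ≤ a) (hb : 0 ≤ b) (hθ : 0 < θ) :
    (a + b) ^ θ ≤ 2 ^ θ * (a ^ θ + b ^ θ) := by
  have h1 : (a + b) ^ θ ≤ (2 * max a b) ^ θ :=
    Real.rpow_le_rpow (by positivity)
      (by linarith [le_max_left a b, le_max_right a b]) hθ.le
  rw [Real.mul_rpow (by norm_num) (le_max_of_le_left ha)] at h1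
  refine h1.trans (mul_le_mul_of_nonneg_left ?_ (by positivity))
  have h2 : 0 ≤ a ^ θ := by positivity
  have h3 : 0 ≤ b ^ θ := by positivity
  rcases max_choice a b with h | h <;> rw [h] <;> linarith

lemma polyWeight_add_le {d : ℕ} {θ : ℝ} (hθ : 0 < θ) (x₀ x η : EuclideanSpace ℝ (Fin d))
    (r : ℝ) (hr : 0 ≤ r) :
    polyWeight θ x₀ (x + r • η) ≤ 1 + 2 ^ θ * (‖x - x₀‖ ^ θ + r ^ θ * ‖η‖ ^ θ) := by
  have h1 : ‖x + r • η - x₀‖ ≤ ‖x - x₀‖ + r * ‖η‖ := by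
    have := norm_add_le (x - x₀) (r • η)
    rwa [norm_smul, Real.norm_of_nonneg hr, sub_add_eq_add_sub] at this
  have h2 := Real.rpow_le_rpow (norm_nonneg _) h1 hθ.le
  have h3 := add_rpow_le_two_rpow_mul (norm_nonneg (x - x₀)) (mul_nonneg hr (norm_nonneg η)) hθ
  rw [Real.mul_rpow hr (norm_nonneg η)] at h3
  unfold polyWeight
  linarith

lemma integrable_polyWeight {d : ℕ} {θ : ℝ} (hθ : 0 < θ) (x₀ x : EuclideanSpace ℝ (Fin d))
    (r : ℝ) (hr : 0 ≤ r) :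
    Integrable (fun η => polyWeight θ x₀ (x + r • η))
      (stdGaussian (EuclideanSpace ℝ (Fin d))) := by
  refine Integrable.mono' (g := fun η => 1 + 2 ^ θ * (‖x - x₀‖ ^ θ + r ^ θ * ‖η‖ ^ θ)) ?_ ?_ ?_
  · exact (integrable_const _).add (((integrable_const _).add
      ((integrable_norm_rpow_stdGaussian hθ).const_mul _)).const_mul _)
  · exact ((continuous_polyWeight hθ x₀).comp (by fun_prop)).aestronglyMeasurable
  · refine Eventually.of_forall fun η => ?_
    rw [Real.norm_of_nonneg (zero_le_one.trans (one_le_polyWeight _ _ _))]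
    exact polyWeight_add_le hθ x₀ x η r hr

lemma continuous_heatSemigroup_polyWeight {d : ℕ} {θ : ℝ} (hθ : 0 < θ)
    (x₀ : EuclideanSpace ℝ (Fin d)) :
    Continuous fun p : ℝ × EuclideanSpace ℝ (Fin d) =>
      heatSemigroup p.1 (polyWeight θ x₀) p.2 := by
  rw [continuous_iff_continuousAt]
  intro p
  unfold heatSemigroup
  have hnorm : ∀ᶠ q : ℝ × EuclideanSpace ℝ (Fin d) in 𝓝 p, ‖q.2 - x₀‖ < ‖p.2 - x₀‖ + 1 :=
    (by fun_prop : Continuous fun q : ℝ × EuclideanSpace ℝ (Fin d) =>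
      ‖q.2 - x₀‖).continuousAt.eventually_lt continuousAt_const (lt_add_one _)
  have hsqrt : ∀ᶠ q : ℝ × EuclideanSpace ℝ (Fin d) in 𝓝 p, √q.1 < √p.1 + 1 :=
    (by fun_prop : Continuous fun q : ℝ × EuclideanSpace ℝ (Fin d) =>
      √q.1).continuousAt.eventually_lt continuousAt_const (lt_add_one _)
  refine continuousAt_of_dominated (bound := fun η =>
    1 + 2 ^ θ * ((‖p.2 - x₀‖ + 1) ^ θ + (√p.1 + 1) ^ θ * ‖η‖ ^ θ)) ?_ ?_ ?_ ?_
  · exact Eventually.of_forall fun q =>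
      ((continuous_polyWeight hθ x₀).comp (by fun_prop)).aestronglyMeasurable
  · filter_upwards [hnorm, hsqrt] with q h1 h2
    refine Eventually.of_forall fun η => ?_
    rw [Real.norm_of_nonneg (zero_le_one.trans (one_le_polyWeight _ _ _))]
    refine (polyWeight_add_le hθ x₀ q.2 η _ (Real.sqrt_nonneg _)).trans ?_
    gcongr
  · exact (integrable_const _).add (((integrable_const _).add
      ((integrable_norm_rpow_stdGaussian hθ).const_mul _)).const_mul _)
  · exact Eventually.of_forall fun η =>
      ((continuous_polyWeight hθ x₀).comp (by fun_prop)).continuousAt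

/-- Integrate the quasi-triangle inequality for $|\cdot|^\theta$; the Gaussian moment comes with
$t^{\theta/2}\le e^{\theta t/2}$, from $\sqrt t\le e^{t/2}$. -/
lemma heatSemigroup_polyWeight_le {d : ℕ} {θ : ℝ} (hθ : 0 < θ)
    (x₀ : EuclideanSpace ℝ (Fin d)) {t : ℝ} (ht : 0 ≤ t) (x : EuclideanSpace ℝ (Fin d)) :
    heatSemigroup t (polyWeight θ x₀) x ≤
      (1 + 2 ^ θ + 2 ^ θ * gaussianMoment d θ) * Real.exp (θ / 2 * t) * polyWeight θ x₀ x := by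
  have hi := integrable_norm_rpow_stdGaussian (d := d) hθ
  have hi2 : Integrable (fun η => ‖x - x₀‖ ^ θ + √t ^ θ * ‖η‖ ^ θ)
      (stdGaussian (EuclideanSpace ℝ (Fin d))) := (integrable_const _).add (hi.const_mul _)
  have h1 : heatSemigroup t (polyWeight θ x₀) x ≤
      ∫ η, (1 + 2 ^ θ * (‖x - x₀‖ ^ θ + √t ^ θ * ‖η‖ ^ θ))
        ∂stdGaussian (EuclideanSpace ℝ (Fin d)) := by
    refine integral_mono (integrable_polyWeight hθ x₀ x _ (Real.sqrt_nonneg t)) ?_ fun η =>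
      polyWeight_add_le hθ x₀ x η _ (Real.sqrt_nonneg _)
    exact (integrable_const _).add (hi2.const_mul _)
  rw [integral_add (integrable_const _) (hi2.const_mul _), integral_const_mul,
    integral_add (integrable_const _) (hi.const_mul _), integral_const_mul, ← gaussianMoment]
    at h1
  simp only [integral_const, probReal_univ, smul_eq_mul, one_mul] at h1
  have hE : (1 : ℝ) ≤ Real.exp (θ / 2 * t) := Real.one_le_exp (by positivity)
  have hs : √t ^ θ ≤ Real.exp (θ / 2 * t) := by
    have h2 : √t ≤ Real.exp (t / 2) := by
      rw [show t / 2 = 1 / 2 * t by ring, Real.sqrt_le_left (Real.exp_pos _).le, ← Real.exp_nat_mul]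
      refine le_trans ?_ (Real.add_one_le_exp _)
      push_cast; linarith
    refine (Real.rpow_le_rpow (Real.sqrt_nonneg _) h2 hθ.le).trans_eq ?_
    rw [← Real.exp_mul]
    congr 1; ring
  have hM := gaussianMoment_nonneg d θ
  have h2θ : (0 : ℝ) ≤ 2 ^ θ := by positivity
  have hn : 0 ≤ ‖x - x₀‖ ^ θ := by positivity
  unfold polyWeight
  set e := Real.exp (θ / 2 * t)
  set n := ‖x - x₀‖ ^ θ
  set c : ℝ := 2 ^ θ
  set M := gaussianMoment d θ
  refine h1.trans ?_
  have a1 : c * n ≤ c * n * e := le_mul_of_one_le_right (by positivity) hE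
  have a2 : c * (√t ^ θ * M) ≤ c * (e * M) := by gcongr
  have a3 : 0 ≤ n * e + c * e + c * M * e * n := by positivity
  nlinarith

/-- Average over $\pm\eta$: one of $x\pm\sqrt t\,\eta$ is at least as far from $x_0$ as $x$ is. This
avoids convexity of the weight, which fails for $\theta<1$. -/
lemma le_heatSemigroup_polyWeight {d : ℕ} {θ : ℝ} (hθ : 0 < θ)
    (x₀ : EuclideanSpace ℝ (Fin d)) (t : ℝ) (x : EuclideanSpace ℝ (Fin d)) :
    polyWeight θ x₀ x / 2 ≤ heatSemigroup t (polyWeight θ x₀) x := by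
  have hi := integrable_polyWeight hθ x₀ x _ (Real.sqrt_nonneg t)
  have hneg : Measure.map (fun η => -η) (stdGaussian (EuclideanSpace ℝ (Fin d))) =
      stdGaussian (EuclideanSpace ℝ (Fin d)) :=
    stdGaussian_map (LinearIsometryEquiv.neg ℝ)
  have hmp : MeasurePreserving (fun η => -η) (stdGaussian (EuclideanSpace ℝ (Fin d)))
      (stdGaussian (EuclideanSpace ℝ (Fin d))) := ⟨by fun_prop, hneg⟩
  have hi' : Integrable (fun η => polyWeight θ x₀ (x + √t • -η))
      (stdGaussian (EuclideanSpace ℝ (Fin d))) := hmp.integrable_comp_of_integrable hi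
  have h1 : heatSemigroup t (polyWeight θ x₀) x =
      ∫ η, polyWeight θ x₀ (x + √t • -η) ∂stdGaussian (EuclideanSpace ℝ (Fin d)) := by
    have := integral_map (μ := stdGaussian (EuclideanSpace ℝ (Fin d))) (φ := fun η => -η)
      (by fun_prop) (f := fun η => polyWeight θ x₀ (x + √t • η))
      ((continuous_polyWeight hθ x₀).comp (by fun_prop)).aestronglyMeasurable
    rw [hneg] at this
    exact this
  have h2 : 2 * heatSemigroup t (polyWeight θ x₀) x =
      ∫ η, (polyWeight θ x₀ (x + √t • η) + polyWeight θ x₀ (x + √t • -η))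
        ∂stdGaussian (EuclideanSpace ℝ (Fin d)) := by
    rw [integral_add hi hi', ← h1, heatSemigroup]; ring
  have h3 : polyWeight θ x₀ x ≤ 2 * heatSemigroup t (polyWeight θ x₀) x := by
    rw [h2]
    have : ∫ _ : EuclideanSpace ℝ (Fin d), polyWeight θ x₀ x
        ∂stdGaussian (EuclideanSpace ℝ (Fin d)) = polyWeight θ x₀ x := by simp
    rw [← this]
    refine integral_mono (integrable_const _) (hi.add hi') fun η => ?_
    simp only [polyWeight]
    have key : ‖x - x₀‖ ≤ max ‖x + √t • η - x₀‖ ‖x + √t • -η - x₀‖ := by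
      have e : (2 : ℝ) • (x - x₀) = (x + √t • η - x₀) + (x + √t • -η - x₀) := by
        rw [smul_neg, two_smul]; abel
      have := norm_add_le (x + √t • η - x₀) (x + √t • -η - x₀)
      rw [← e, norm_smul] at this
      norm_num at this
      by_contra! hlt
      have := max_lt_iff.1 hlt
      simp only [smul_neg] at *
      linarith [this.1, this.2]
    have hp1 : 0 ≤ ‖x + √t • η - x₀‖ ^ θ := by positivity
    have hp2 : 0 ≤ ‖x + √t • -η - x₀‖ ^ θ := by positivity
    rcases le_max_iff.1 key with h | h <;>
    · have := Real.rpow_le_rpow (norm_nonneg _) h hθ.le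
      linarith
  linarith

/-! ### The comparison principle in mild form. -/

/-- Comparison principle: a heat potential stays below the barrier `2 m e^{lt} P_t ρ` if, wherever
it reaches the height `m ρ`, its source is smaller than `l` times its value. -/
lemma duhamel_lt_barrier {d : ℕ} {θ : ℝ} (hθ : 0 < θ) (x₀ : EuclideanSpace ℝ (Fin d))
    {m l T : ℝ} (hm : 0 < m) (hl : 0 ≤ l) {g : ℝ → EuclideanSpace ℝ (Fin d) → ℝ}
    (hg : Continuous (Function.uncurry g)) {B : ℝ} (hB : ∀ s x, |g s x| ≤ B)
    (H : ∀ t ∈ Icc 0 T, ∀ x, m * polyWeight θ x₀ x ≤ duhamel g t x →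
      g t x < l * duhamel g t x) :
    ∀ t ∈ Icc 0 T, ∀ x,
      duhamel g t x < 2 * m * Real.exp (l * t) * heatSemigroup t (polyWeight θ x₀) x := by
  by_contra! hcon
  obtain ⟨t₁, ht₁, x₁, h₁⟩ := hcon
  -- The factor 2 compensates the $1/2$ in `le_heatSemigroup_polyWeight`, so that $W\ge m\rho$.
  set W : ℝ → EuclideanSpace ℝ (Fin d) → ℝ := fun t x =>
    2 * m * Real.exp (l * t) * heatSemigroup t (polyWeight θ x₀) x with hW
  have hWcont : Continuous (Function.uncurry W) := by
    have := continuous_heatSemigroup_polyWeight hθ x₀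
    exact (by fun_prop : Continuous fun p : ℝ × EuclideanSpace ℝ (Fin d) =>
      2 * m * Real.exp (l * p.1)).mul this
  have hWge : ∀ t, 0 ≤ t → ∀ x, m * polyWeight θ x₀ x ≤ W t x := fun t ht x => by
    have h1 := le_heatSemigroup_polyWeight hθ x₀ t x
    have h2 : 1 ≤ Real.exp (l * t) := Real.one_le_exp (by positivity)
    have h3 := one_le_polyWeight θ x₀ x
    calc m * polyWeight θ x₀ x = 2 * m * 1 * (polyWeight θ x₀ x / 2) := by ring
      _ ≤ 2 * m * Real.exp (l * t) * heatSemigroup t (polyWeight θ x₀) x := by gcongr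
  have hvcont := continuous_duhamel hg hB
  have hvle : ∀ t ∈ Icc 0 T, ∀ x, duhamel g t x ≤ B * T := fun t ht x => by
    have h := abs_duhamel_le (b := fun _ => B) ht.1 continuous_const (fun s _ y => hB s y) x
    have hB0 : 0 ≤ B := (abs_nonneg _).trans (hB 0 0)
    simp only [intervalIntegral.integral_const, sub_zero, smul_eq_mul] at h
    refine (le_abs_self _).trans (h.trans ?_)
    rw [mul_comm]
    exact mul_le_mul_of_nonneg_left ht.2 hB0
  -- The contact set is compact because $W\ge m\rho$ grows while the potential is at most $BT$;
  -- hence there is a first contact time $t_0$.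
  set S : Set (ℝ × EuclideanSpace ℝ (Fin d)) :=
    {p | p.1 ∈ Icc 0 T ∧ W p.1 p.2 ≤ duhamel g p.1 p.2} with hS
  have hSclosed : IsClosed S :=
    (isClosed_Icc.preimage continuous_fst).inter (isClosed_le hWcont hvcont)
  have hSsub : S ⊆ Icc 0 T ×ˢ Metric.closedBall x₀ ((B * T / m) ^ θ⁻¹) := by
    rintro ⟨t, x⟩ ⟨ht, hx⟩
    refine ⟨ht, ?_⟩
    have h1 := (hWge t ht.1 x).trans (hx.trans (hvle t ht x))
    rw [mem_closedBall_iff_norm]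
    have h2 : ‖x - x₀‖ ^ θ ≤ B * T / m := by
      rw [le_div_iff₀ hm]
      unfold polyWeight at h1
      linarith
    have h3 : 0 ≤ B * T / m := le_trans (by positivity) h2
    rwa [Real.le_rpow_inv_iff_of_pos (norm_nonneg _) h3 hθ]
  have hScomp : IsCompact S :=
    (isCompact_Icc.prod (isCompact_closedBall _ _)).of_isClosed_subset hSclosed hSsub
  obtain ⟨⟨t₀, x⟩, ⟨ht₀, hx⟩, hmin⟩ :=
    hScomp.exists_isMinOn ⟨(t₁, x₁), ht₁, h₁⟩ continuous_fst.continuousOn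
  simp only at ht₀ hx
  have hbelow : ∀ t, 0 ≤ t → t < t₀ → ∀ y, duhamel g t y < W t y := fun t h0 ht y => by
    by_contra! hle
    have : t₀ ≤ t := hmin (a := (t, y)) ⟨⟨h0, ht.le.trans ht₀.2⟩, hle⟩
    exact absurd ht this.not_gt
  have hxw := (hWge t₀ ht₀.1 x).trans hx
  have hpos : 0 < t₀ := by
    refine lt_of_le_of_ne ht₀.1 fun h => ?_
    have h0 : duhamel g t₀ x = 0 := by rw [← h]; simp [duhamel]
    have h3 := one_le_polyWeight θ x₀ x
    have : 0 < m * polyWeight θ x₀ x := by positivity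
    linarith
  have hgt := H t₀ ht₀ x hxw
  have hqc := continuous_heatSemigroup_sub hg hB t₀ x
  set q : ℝ → ℝ := fun s => heatSemigroup (t₀ - s) (g s) x with hq
  have hq0 : q t₀ = g t₀ x := by simp [hq, heatSemigroup_zero]
  set w := duhamel g t₀ x with hw
  -- Restart at $s$: the potential is below $W(s)$ there, and $P_{t_0-s}W(s)=e^{-l(t_0-s)}W(t_0)$
  -- with $W(t_0,x)\le w$.
  have hineq : ∀ s, 0 ≤ s → s < t₀ → w ≤ Real.exp (-(l * (t₀ - s))) * w + ∫ r in s..t₀, q r := by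
    intro s hs0 hst
    have h1 := duhamel_add hg hB hs0 (sub_nonneg.2 hst.le) x
    rw [add_sub_cancel] at h1
    rw [hw, h1]
    refine add_le_add ?_ le_rfl
    rw [← h1, ← hw]
    refine le_trans ?_ (mul_le_mul_of_nonneg_left hx (Real.exp_pos _).le)
    have h2 : heatSemigroup (t₀ - s) (W s) x = Real.exp (-(l * (t₀ - s))) * W t₀ x := by
      have h3 := heatSemigroup_add (sub_nonneg.2 hst.le) hs0 (continuous_polyWeight hθ x₀) x
        (integrable_polyWeight hθ x₀ x _ (Real.sqrt_nonneg _))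
      rw [sub_add_cancel] at h3
      have h4 : heatSemigroup (t₀ - s) (W s) x = 2 * m * Real.exp (l * s) *
          heatSemigroup (t₀ - s) (heatSemigroup s (polyWeight θ x₀)) x := by
        simp only [heatSemigroup.eq_1 (t₀ - s), hW, integral_const_mul]
      rw [h4, h3, hW]
      simp only
      rw [show l * t₀ = l * (t₀ - s) + l * s by ring, Real.exp_add, Real.exp_neg]
      field_simp
    rw [← h2]
    have hvi : Integrable (fun η => duhamel g s (x + √(t₀ - s) • η))
        (stdGaussian (EuclideanSpace ℝ (Fin d))) := by
      refine Integrable.of_bound (((hvcont.uncurry_left s).comp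
        (by fun_prop)).aestronglyMeasurable) (∫ _ in (0 : ℝ)..s, B)
        (Eventually.of_forall fun η => ?_)
      exact abs_duhamel_le hs0 continuous_const (fun s _ y => hB s y) _
    by_cases hWi : Integrable (fun η => W s (x + √(t₀ - s) • η))
        (stdGaussian (EuclideanSpace ℝ (Fin d)))
    · exact integral_mono hvi hWi fun η => (hbelow s hs0 hst _).le
    · refine absurd ?_ hWi
      refine Integrable.mono' (g := fun η => 2 * m * Real.exp (l * s) *
        ((1 + 2 ^ θ + 2 ^ θ * gaussianMoment d θ) * Real.exp (θ / 2 * s) *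
          polyWeight θ x₀ (x + √(t₀ - s) • η))) ?_ ?_ ?_
      · exact ((integrable_polyWeight hθ x₀ x _ (Real.sqrt_nonneg _)).const_mul _).const_mul _
      · exact ((hWcont.uncurry_left s).comp (by fun_prop)).aestronglyMeasurable
      · refine Eventually.of_forall fun η => ?_
        have h5 := one_le_polyWeight θ x₀ (x + √(t₀ - s) • η)
        rw [Real.norm_of_nonneg (le_trans (by positivity) (hWge s hs0 _))]
        exact mul_le_mul_of_nonneg_left (heatSemigroup_polyWeight_le hθ x₀ hs0 _)
          (by positivity)
  -- The right side of `hineq` equals $w$ at $s=t_0$ and has derivative $lw-g(t_0,x)>0$ there, so it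
  -- falls below $w$ just before $t_0$: a contradiction.
  have hderiv : HasDerivAt (fun s => Real.exp (-(l * (t₀ - s))) * w + ∫ r in s..t₀, q r)
      (l * w - q t₀) t₀ := by
    have d1 : HasDerivAt (fun s => Real.exp (-(l * (t₀ - s))) * w) (l * w) t₀ := by
      have := ((((hasDerivAt_id t₀).const_sub t₀).const_mul l).neg.exp).mul_const w
      simpa using this
    have d2 : HasDerivAt (fun s => ∫ r in s..t₀, q r) (-q t₀) t₀ :=
      intervalIntegral.integral_hasDerivAt_left (hqc.intervalIntegrable _ _)
        (hqc.stronglyMeasurableAtFilter _ _) hqc.continuousAt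
    rw [sub_eq_add_neg]
    exact d1.add d2
  have hslope := hderiv.tendsto_slope
  have hev : ∀ᶠ s in 𝓝[<] t₀,
      0 < slope (fun s => Real.exp (-(l * (t₀ - s))) * w + ∫ r in s..t₀, q r) t₀ s :=
    (hslope.mono_left (nhdsWithin_mono _ fun s (hs : s < t₀) => hs.ne)).eventually
      (lt_mem_nhds (by linarith))
  obtain ⟨s, hs, hs0, hst⟩ := (hev.and (Ioo_mem_nhdsLT hpos)).exists
  rw [slope_def_field] at hs
  simp only [sub_self, mul_zero, neg_zero, Real.exp_zero, one_mul,
    intervalIntegral.integral_same, add_zero] at hs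
  have := hineq s hs0.le hst
  rcases div_pos_iff.1 hs with h | h <;> linarith [h.1, h.2]

/-- The constant in the pointwise form of the comparison principle. -/
noncomputable def barrierConst (d : ℕ) (θ : ℝ) : ℝ :=
  2 * (1 + 2 ^ θ + 2 ^ θ * gaussianMoment d θ)

lemma barrierConst_pos (d : ℕ) (θ : ℝ) : 0 < barrierConst d θ := by
  have := gaussianMoment_nonneg d θ
  unfold barrierConst; positivity

lemma duhamel_le_barrier {d : ℕ} {θ : ℝ} (hθ : 0 < θ) (x₀ : EuclideanSpace ℝ (Fin d))
    {m l T : ℝ} (hm : 0 < m) (hl : 0 ≤ l) {g : ℝ → EuclideanSpace ℝ (Fin d) → ℝ}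
    (hg : Continuous (Function.uncurry g)) {B : ℝ} (hB : ∀ s x, |g s x| ≤ B)
    (H : ∀ t ∈ Icc 0 T, ∀ x, m * polyWeight θ x₀ x ≤ duhamel g t x →
      g t x < l * duhamel g t x) {t : ℝ} (ht : t ∈ Icc 0 T) (x : EuclideanSpace ℝ (Fin d)) :
    duhamel g t x ≤
      m * barrierConst d θ * Real.exp ((l + θ / 2) * T) * polyWeight θ x₀ x := by
  have h1 := duhamel_lt_barrier hθ x₀ hm hl hg hB H t ht x
  have h2 := heatSemigroup_polyWeight_le hθ x₀ ht.1 x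
  have h3 := one_le_polyWeight θ x₀ x
  have h4 := gaussianMoment_nonneg d θ
  have h5 : t ≤ T := ht.2
  refine h1.le.trans ?_
  calc 2 * m * Real.exp (l * t) * heatSemigroup t (polyWeight θ x₀) x
      ≤ 2 * m * Real.exp (l * T) * ((1 + 2 ^ θ + 2 ^ θ * gaussianMoment d θ) *
          Real.exp (θ / 2 * T) * polyWeight θ x₀ x) := by
        refine mul_le_mul (by gcongr) (h2.trans (by gcongr)) ?_ (by positivity)
        exact le_trans (by positivity) (le_heatSemigroup_polyWeight hθ x₀ t x)
    _ = _ := by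
        rw [add_mul l, Real.exp_add, barrierConst]; ring

lemma abs_duhamel_le_barrier {d : ℕ} {θ : ℝ} (hθ : 0 < θ) (x₀ : EuclideanSpace ℝ (Fin d))
    {m l T : ℝ} (hm : 0 < m) (hl : 0 ≤ l) {g : ℝ → EuclideanSpace ℝ (Fin d) → ℝ}
    (hg : Continuous (Function.uncurry g)) {B : ℝ} (hB : ∀ s x, |g s x| ≤ B)
    (H : ∀ t ∈ Icc 0 T, ∀ x, m * polyWeight θ x₀ x ≤ duhamel g t x →
      g t x < l * duhamel g t x)
    (H' : ∀ t ∈ Icc 0 T, ∀ x, duhamel g t x ≤ -(m * polyWeight θ x₀ x) →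
      l * duhamel g t x < g t x) {t : ℝ} (ht : t ∈ Icc 0 T) (x : EuclideanSpace ℝ (Fin d)) :
    |duhamel g t x| ≤
      m * barrierConst d θ * Real.exp ((l + θ / 2) * T) * polyWeight θ x₀ x := by
  refine abs_le'.2 ⟨duhamel_le_barrier hθ x₀ hm hl hg hB H ht x, ?_⟩
  rw [← duhamel_neg]
  refine duhamel_le_barrier hθ x₀ hm hl (g := fun s y => -g s y) hg.neg
    (B := B) (by simpa using hB) (fun t ht x hx => ?_) ht x
  rw [duhamel_neg] at hx ⊢
  linarith [H' t ht x (by linarith)]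

/-! ### A priori bound, stability and uniqueness for the mild equation. -/

/-- The source `f(u)`, extended in time from `[0,T]` to `ℝ` by projection. -/
noncomputable def mildSource {d : ℕ} {T : ℝ} (hT : 0 ≤ T) (f : ℝ → ℝ) (u : Cb T d) (s : ℝ)
    (y : EuclideanSpace ℝ (Fin d)) : ℝ :=
  f (u (projIcc 0 T hT s, y))

lemma continuous_mildSource {d : ℕ} {T : ℝ} (hT : 0 ≤ T) {f : ℝ → ℝ} (hf : Continuous f)
    (u : Cb T d) : Continuous (Function.uncurry (mildSource hT f u)) :=
  hf.comp (u.continuous.comp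
    ((continuous_projIcc.comp continuous_fst).prodMk continuous_snd))

lemma exists_bound_mildSource {d : ℕ} {T : ℝ} (hT : 0 ≤ T) {f : ℝ → ℝ} (hf : Continuous f)
    (u : Cb T d) : ∃ B, ∀ s y, |mildSource hT f u s y| ≤ B := by
  obtain ⟨B, hB⟩ := (isCompact_Icc (a := -‖u‖) (b := ‖u‖)).exists_bound_of_continuousOn
    hf.continuousOn
  exact ⟨B, fun s y => hB _ (abs_le.1 (u.norm_coe_le_norm _))⟩

/-- Kernel and semigroup forms of the integrand can differ only at $s=t$, a null set. -/
lemma solvesMildEq_iff {d : ℕ} {T : ℝ} (hT : 0 ≤ T) {f : ℝ → ℝ} {z u : Cb T d} :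
    SolvesMildEq f z u ↔ ∀ (t : Icc (0 : ℝ) T) (x : EuclideanSpace ℝ (Fin d)),
      u (t, x) = duhamel (mildSource hT f u) t x + z (t, x) := by
  refine forall₂_congr fun t x => ?_
  have : (∫ s in (0 : ℝ)..(t : ℝ), ∫ y : EuclideanSpace ℝ (Fin d),
      heatKernel ((t : ℝ) - s) (x - y) *
        f (u (projIcc 0 T (t.2.1.trans t.2.2) s, y))) =
      duhamel (mildSource hT f u) t x := by
    refine intervalIntegral.integral_congr_ae ?_
    filter_upwards [compl_mem_ae_iff.2 (measure_singleton (t : ℝ))] with s hs hst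
    rw [uIoc_of_le t.2.1] at hst
    exact integral_heatKernel_mul (sub_pos.2 (lt_of_le_of_ne hst.2 hs)) _ x
  rw [this]

lemma SolvesMildEq.duhamel_eq {d : ℕ} {T : ℝ} (hT : 0 ≤ T) {f : ℝ → ℝ} {z u : Cb T d}
    (h : SolvesMildEq f z u) {t : ℝ} (ht : t ∈ Icc 0 T) (x : EuclideanSpace ℝ (Fin d)) :
    duhamel (mildSource hT f u) t x = u (⟨t, ht⟩, x) - z (⟨t, ht⟩, x) := by
  have := (solvesMildEq_iff hT).1 h ⟨t, ht⟩ x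
  simp only at this
  linarith

lemma mildSource_of_mem {d : ℕ} {T : ℝ} (hT : 0 ≤ T) (f : ℝ → ℝ) (u : Cb T d) {t : ℝ}
    (ht : t ∈ Icc 0 T) (x : EuclideanSpace ℝ (Fin d)) :
    mildSource hT f u t x = f (u (⟨t, ht⟩, x)) := by
  rw [mildSource, projIcc_of_mem hT ht]

/-- A priori bound with polynomial weight. -/
lemma SolvesMildEq.abs_le_polyWeight {d : ℕ} {θ κ F T N : ℝ} (hθ : 0 < θ) (hT : 0 ≤ T) {f : ℝ → ℝ}
    (hf : Continuous f) (hκ : ∀ u₁ u₂ : ℝ, u₁ < u₂ → f u₂ - f u₁ ≤ κ * (u₂ - u₁))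
    (hF : |f 0| ≤ F) {z u : Cb T d} (h : SolvesMildEq f z u) (x₀ : EuclideanSpace ℝ (Fin d))
    (hN : 0 ≤ N) (hz : ∀ t x, |z (t, x)| ≤ N * polyWeight θ x₀ x) (t : Icc (0 : ℝ) T)
    (x : EuclideanSpace ℝ (Fin d)) :
    |u (t, x)| ≤ ((1 + N) * barrierConst d θ *
      Real.exp ((2 * |κ| + |F| + 1 + θ / 2) * T) + N) * polyWeight θ x₀ x := by
  obtain ⟨B, hB⟩ := exists_bound_mildSource hT hf u
  have hFF := le_abs_self F
  have hf0 := abs_le.1 (hF.trans hFF)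
  -- If $v=u-z\ge(1+N)\rho$, then $v\ge1$ and $|z|\le N\rho\le v$, so $0<u\le2v$ and
  -- $f(u)\le|F|+\kappa u\le(|F|+2|\kappa|)v<lv$. The negative side is symmetric.
  have hmain := abs_duhamel_le_barrier hθ x₀ (m := 1 + N) (l := 2 * |κ| + |F| + 1) (T := T)
    (by linarith) (by positivity) (continuous_mildSource hT hf u) hB ?_ ?_ t.2 x
  · rw [h.duhamel_eq hT t.2] at hmain
    have h1 := hz t x
    have h2 := abs_add_le (u (t, x) - z (t, x)) (z (t, x))
    rw [sub_add_cancel] at h2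
    rw [add_mul]
    linarith
  · intro s hs y hy
    have hw := one_le_polyWeight θ x₀ y
    rw [mildSource_of_mem hT f u hs]
    rw [h.duhamel_eq hT hs] at hy ⊢
    have hzs := abs_le.1 (hz ⟨s, hs⟩ y)
    set a := u (⟨s, hs⟩, y)
    set b := z (⟨s, hs⟩, y)
    have h1 : 1 ≤ a - b := by nlinarith
    have h0 : 0 < a := by nlinarith
    have h2 : a ≤ 2 * (a - b) := by nlinarith
    have h3 := hκ 0 a h0
    have h4 : κ * a ≤ |κ| * (2 * (a - b)) :=
      (mul_le_mul_of_nonneg_right (le_abs_self κ) h0.le).trans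
        (mul_le_mul_of_nonneg_left h2 (abs_nonneg κ))
    have h5 : |F| ≤ |F| * (a - b) := le_mul_of_one_le_right (abs_nonneg F) h1
    linarith [hf0.2]
  · intro s hs y hy
    have hw := one_le_polyWeight θ x₀ y
    rw [mildSource_of_mem hT f u hs]
    rw [h.duhamel_eq hT hs] at hy ⊢
    have hzs := abs_le.1 (hz ⟨s, hs⟩ y)
    set a := u (⟨s, hs⟩, y)
    set b := z (⟨s, hs⟩, y)
    have h1 : 1 ≤ b - a := by nlinarith
    have h0 : a < 0 := by nlinarith
    have h2 : -a ≤ 2 * (b - a) := by nlinarith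
    have h3 := hκ a 0 h0
    have h4 : κ * -a ≤ |κ| * (2 * (b - a)) :=
      (mul_le_mul_of_nonneg_right (le_abs_self κ) (by linarith)).trans
        (mul_le_mul_of_nonneg_left h2 (abs_nonneg κ))
    have h5 : |F| ≤ |F| * (b - a) := le_mul_of_one_le_right (abs_nonneg F) h1
    linarith [hf0.1]

/-- Stability of mild solutions under perturbation of the nonlinearity. -/
lemma SolvesMildEq.abs_sub_le_of_near {d : ℕ} {κ T δ : ℝ} (hT : 0 ≤ T) (hδ : 0 < δ)
    {f f₁ f₂ : ℝ → ℝ} (hf₁ : Continuous f₁) (hf₂ : Continuous f₂)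
    (hκ : ∀ u₁ u₂ : ℝ, u₁ < u₂ → f u₂ - f u₁ ≤ κ * (u₂ - u₁))
    (h₁ : ∀ r, |f₁ r - f r| ≤ δ) (h₂ : ∀ r, |f₂ r - f r| ≤ δ) {z u₁ u₂ : Cb T d}
    (hu₁ : SolvesMildEq f₁ z u₁) (hu₂ : SolvesMildEq f₂ z u₂) (t : Icc (0 : ℝ) T)
    (x : EuclideanSpace ℝ (Fin d)) :
    |u₁ (t, x) - u₂ (t, x)| ≤
      4 * δ * barrierConst d 1 * Real.exp ((|κ| + 1 + 1 / 2) * T) := by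
  obtain ⟨B₁, hB₁⟩ := exists_bound_mildSource hT hf₁ u₁
  obtain ⟨B₂, hB₂⟩ := exists_bound_mildSource hT hf₂ u₂
  have hc₁ := continuous_mildSource hT hf₁ u₁
  have hc₂ := continuous_mildSource hT hf₂ u₂
  have hdu : ∀ s (hs : s ∈ Icc 0 T) y,
      duhamel (fun s y => mildSource hT f₁ u₁ s y - mildSource hT f₂ u₂ s y) s y =
        u₁ (⟨s, hs⟩, y) - u₂ (⟨s, hs⟩, y) := fun s hs y => by
    rw [duhamel_sub hc₁ hc₂ hB₁ hB₂, hu₁.duhamel_eq hT hs, hu₂.duhamel_eq hT hs]; ring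
  -- The datum $z$ cancels. If $v=u_1-u_2\ge4\delta$, the sources differ by at most $\kappa
  -- v+2\delta<(|\kappa|+1)v$. Centring the weight at $x$ makes it 1 there.
  have hmain := abs_duhamel_le_barrier zero_lt_one x (m := 4 * δ) (l := |κ| + 1) (T := T)
    (by linarith) (by positivity) (hc₁.sub hc₂)
    (g := fun s y => mildSource hT f₁ u₁ s y - mildSource hT f₂ u₂ s y)
    (B := B₁ + B₂) (fun s y => (abs_sub _ _).trans (add_le_add (hB₁ s y) (hB₂ s y))) ?_ ?_ t.2 x
  · rw [hdu t t.2] at hmain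
    simpa [polyWeight] using hmain
  · intro s hs y hy
    have hw := one_le_polyWeight 1 x y
    rw [hdu s hs] at hy ⊢
    simp only [mildSource_of_mem hT _ _ hs]
    set a := u₁ (⟨s, hs⟩, y)
    set b := u₂ (⟨s, hs⟩, y)
    have h0 : 4 * δ ≤ a - b := by nlinarith
    have h1 := hκ b a (by linarith)
    have h2 := mul_le_mul_of_nonneg_right (le_abs_self κ) (by linarith : 0 ≤ a - b)
    linarith [(abs_le.1 (h₁ a)).2, (abs_le.1 (h₂ b)).1]
  · intro s hs y hy
    have hw := one_le_polyWeight 1 x y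
    rw [hdu s hs] at hy ⊢
    simp only [mildSource_of_mem hT _ _ hs]
    set a := u₁ (⟨s, hs⟩, y)
    set b := u₂ (⟨s, hs⟩, y)
    have h0 : 4 * δ ≤ b - a := by nlinarith
    have h1 := hκ a b (by linarith)
    have h2 := mul_le_mul_of_nonneg_right (le_abs_self κ) (by linarith : 0 ≤ b - a)
    linarith [(abs_le.1 (h₁ a)).1, (abs_le.1 (h₂ b)).2]

/-- Stability with $f_1=f_2=f$ holds for every $\delta>0$, with a bound linear in $\delta$. -/
lemma SolvesMildEq.unique {d : ℕ} {κ T : ℝ} (hT : 0 ≤ T) {f : ℝ → ℝ} (hf : Continuous f)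
    (hκ : ∀ u₁ u₂ : ℝ, u₁ < u₂ → f u₂ - f u₁ ≤ κ * (u₂ - u₁)) {z u₁ u₂ : Cb T d}
    (hu₁ : SolvesMildEq f z u₁) (hu₂ : SolvesMildEq f z u₂) : u₁ = u₂ := by
  ext ⟨t, x⟩
  rw [← sub_eq_zero, ← abs_nonpos_iff]
  refine le_of_forall_pos_le_add fun ε hε => ?_
  have hb := barrierConst_pos d 1
  set c := 4 * barrierConst d 1 * Real.exp ((|κ| + 1 + 1 / 2) * T) with hc
  have hc0 : 0 < c := by positivity
  have := hu₁.abs_sub_le_of_near hT (div_pos hε hc0) hf hf hκ (by simp; positivity)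
    (by simp; positivity) hu₂ t x
  refine this.trans_eq ?_
  rw [show 4 * (ε / c) * barrierConst d 1 * Real.exp ((|κ| + 1 + 1 / 2) * T) = ε / c * c by
    rw [hc]; ring]
  field_simp
  ring

/-! ### Existence. -/

/-- The Picard map of the mild equation. -/
noncomputable def mildPicard {d : ℕ} {T : ℝ} (hT : 0 ≤ T) {f : ℝ → ℝ} (hf : Continuous f)
    (z u : Cb T d) : Cb T d :=
  BoundedContinuousFunction.ofNormedAddCommGroup
    (fun p => duhamel (mildSource hT f u) p.1 p.2)
    ((continuous_duhamel (continuous_mildSource hT hf u)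
      (exists_bound_mildSource hT hf u).choose_spec).comp
        (f := fun p : Icc (0 : ℝ) T × EuclideanSpace ℝ (Fin d) => ((p.1 : ℝ), p.2))
        (by fun_prop))
    ((exists_bound_mildSource hT hf u).choose * T) (fun p => by
      have hB := (exists_bound_mildSource hT hf u).choose_spec
      have h := abs_duhamel_le p.1.2.1
        (continuous_const (y := (exists_bound_mildSource hT hf u).choose))
        (fun s _ y => hB s y) p.2
      simp only [intervalIntegral.integral_const, sub_zero, smul_eq_mul] at h
      refine h.trans ?_
      rw [mul_comm]
      exact mul_le_mul_of_nonneg_left p.1.2.2 ((abs_nonneg _).trans (hB 0 0))) + z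

lemma mildPicard_apply {d : ℕ} {T : ℝ} (hT : 0 ≤ T) {f : ℝ → ℝ} (hf : Continuous f)
    (z u : Cb T d) (t : Icc (0 : ℝ) T) (x : EuclideanSpace ℝ (Fin d)) :
    mildPicard hT hf z u (t, x) = duhamel (mildSource hT f u) t x + z (t, x) := rfl

/-- The Volterra factorial makes some iterate a contraction on all of $[0,T]$, however large $T$ is.
-/
lemma abs_iterate_mildPicard_sub_le {d : ℕ} {T : ℝ} (hT : 0 ≤ T) {f : ℝ → ℝ} {K : NNReal}
    (hf : LipschitzWith K f) (z u v : Cb T d) (n : ℕ) (t : Icc (0 : ℝ) T)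
    (x : EuclideanSpace ℝ (Fin d)) :
    |(mildPicard hT hf.continuous z)^[n] u (t, x) -
      (mildPicard hT hf.continuous z)^[n] v (t, x)| ≤
      (K * t) ^ n / n.factorial * ‖u - v‖ := by
  induction n generalizing t x with
  | zero => simpa using (u - v).norm_coe_le_norm (t, x)
  | succ n ih =>
    rw [Function.iterate_succ_apply', Function.iterate_succ_apply', mildPicard_apply,
      mildPicard_apply, add_sub_add_right_eq_sub]
    set u' := (mildPicard hT hf.continuous z)^[n] u
    set v' := (mildPicard hT hf.continuous z)^[n] v
    obtain ⟨B, hB⟩ := exists_bound_mildSource hT hf.continuous u'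
    obtain ⟨B', hB'⟩ := exists_bound_mildSource hT hf.continuous v'
    rw [← duhamel_sub (continuous_mildSource hT hf.continuous u')
      (continuous_mildSource hT hf.continuous v') hB hB']
    have h := abs_duhamel_le
      (g := fun s y => mildSource hT f u' s y - mildSource hT f v' s y)
      (b := fun s => K * ((K * s) ^ n / n.factorial * ‖u - v‖)) t.2.1 (by fun_prop) ?_ x
    · refine h.trans_eq ?_
      have e : ∀ s : ℝ, (K : ℝ) * ((K * s) ^ n / n.factorial * ‖u - v‖) =
          (K ^ (n + 1) / n.factorial * ‖u - v‖) * s ^ n := fun s => by ring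
      simp_rw [e]
      rw [intervalIntegral.integral_const_mul, integral_pow, Nat.factorial_succ]
      have : (n.factorial : ℝ) ≠ 0 := by positivity
      push_cast
      field_simp
      simp only [ne_eq, Nat.add_eq_zero_iff, one_ne_zero, and_false, not_false_eq_true, zero_pow,
        sub_zero]
      ring
    · intro s hs y
      have hs' : s ∈ Icc 0 T := ⟨hs.1, hs.2.trans t.2.2⟩
      rw [mildSource_of_mem hT _ _ hs', mildSource_of_mem hT _ _ hs']
      refine (hf.dist_le_mul _ _).trans ?_
      exact mul_le_mul_of_nonneg_left (ih ⟨s, hs'⟩ y) K.2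

lemma exists_solvesMildEq_of_lipschitz {d : ℕ} {T : ℝ} (hT : 0 ≤ T) {f : ℝ → ℝ} {K : NNReal}
    (hf : LipschitzWith K f) (z : Cb T d) : ∃ u, SolvesMildEq f z u := by
  have hlim := FloorSemiring.tendsto_pow_div_factorial_atTop (K * T)
  obtain ⟨n, hn⟩ := (hlim.eventually (gt_mem_nhds (by norm_num : (0 : ℝ) < 1 / 2))).exists
  have hc : ContractingWith (1 / 2) (mildPicard hT hf.continuous z)^[n] := by
    refine ⟨by rw [← NNReal.coe_lt_coe]; norm_num, LipschitzWith.of_dist_le_mul fun u v => ?_⟩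
    have h0 : 0 ≤ dist u v := dist_nonneg
    refine (BoundedContinuousFunction.dist_le (by positivity)).2 fun p => ?_
    refine (abs_iterate_mildPicard_sub_le hT hf z u v n p.1 p.2).trans ?_
    rw [← dist_eq_norm]
    refine mul_le_mul_of_nonneg_right ?_ h0
    refine le_trans ?_ (hn.le.trans (by simp))
    have h1 := p.1.2.1
    have h2 := p.1.2.2
    gcongr
  obtain ⟨u, hu⟩ : ∃ u, mildPicard hT hf.continuous z u = u :=
    ⟨_, hc.isFixedPt_fixedPoint_iterate⟩
  exact ⟨u, (solvesMildEq_iff hT).2 fun t x => (DFunLike.congr_fun hu (t, x)).symm⟩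

/-- A Weierstrass polynomial on $[a,b]$ composed with the projection. It need not inherit the
one-sided bound, which the stability lemma asks only of the limiting nonlinearity. -/
lemma exists_lipschitzWith_near_projIcc {a b : ℝ} (hab : a ≤ b) {f : ℝ → ℝ} (hf : Continuous f)
    {ε : ℝ} (hε : 0 < ε) :
    ∃ (K : NNReal) (q : ℝ → ℝ), LipschitzWith K q ∧
      ∀ r, |q r - f (projIcc a b hab r)| ≤ ε := by
  obtain ⟨p, hp⟩ := exists_polynomial_near_of_continuousOn a b f hf.continuousOn ε hε
  have hcd : ContDiff ℝ 1 fun r => p.eval r := by simpa using p.contDiff_aeval (𝕜 := ℝ) 1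
  obtain ⟨K, hK⟩ := (hcd.contDiffOn (s := Icc a b)).exists_lipschitzOnWith one_ne_zero
    (convex_Icc a b) isCompact_Icc
  refine ⟨K * 1, fun r => p.eval (projIcc a b hab r : ℝ), ?_, fun r => ?_⟩
  · exact (lipschitzOnWith_iff_restrict.1 hK).comp (LipschitzWith.projIcc hab)
  · exact (hp _ (projIcc a b hab r).2).le

/-- The projection is monotone and 1-Lipschitz. Since it shrinks increments, a negative $\kappa$
would not survive; hence $|\kappa|$. -/
lemma projIcc_one_sided {a b κ : ℝ} (hab : a ≤ b) {f : ℝ → ℝ}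
    (hκ : ∀ u₁ u₂ : ℝ, u₁ < u₂ → f u₂ - f u₁ ≤ κ * (u₂ - u₁)) {u₁ u₂ : ℝ} (h : u₁ < u₂) :
    f (projIcc a b hab u₂) - f (projIcc a b hab u₁) ≤ |κ| * (u₂ - u₁) := by
  have hmono : (projIcc a b hab u₁ : ℝ) ≤ projIcc a b hab u₂ := monotone_projIcc hab h.le
  rcases hmono.eq_or_lt with he | hlt
  · rw [he, sub_self]
    exact mul_nonneg (abs_nonneg κ) (sub_pos.2 h).le
  · refine (hκ _ _ hlt).trans ?_
    have h1 : (projIcc a b hab u₂ : ℝ) - projIcc a b hab u₁ ≤ u₂ - u₁ := by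
      have := (LipschitzWith.projIcc hab).dist_le_mul u₂ u₁
      rw [Subtype.dist_eq, Real.dist_eq, Real.dist_eq, abs_of_pos (sub_pos.2 hlt),
        abs_of_pos (sub_pos.2 h)] at this
      simpa using this
    exact (mul_le_mul_of_nonneg_right (le_abs_self κ) (sub_pos.2 hlt).le).trans
      (mul_le_mul_of_nonneg_left h1 (abs_nonneg κ))

lemma exists_solvesMildEq_projIcc {d : ℕ} {T a b κ : ℝ} (hT : 0 ≤ T) (hab : a ≤ b) {f : ℝ → ℝ}
    (hf : Continuous f) (hκ : ∀ u₁ u₂ : ℝ, u₁ < u₂ → f u₂ - f u₁ ≤ κ * (u₂ - u₁))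
    (z : Cb T d) : ∃ u, SolvesMildEq (fun r => f (projIcc a b hab r)) z u := by
  set k : ℝ → ℝ := fun r => f (projIcc a b hab r) with hk
  have hkc : UniformContinuous k :=
    (CompactSpace.uniformContinuous_of_continuous (hf.comp continuous_subtype_val)).comp
      (LipschitzWith.projIcc hab).uniformContinuous
  have hpos : ∀ n : ℕ, 0 < 1 / ((n : ℝ) + 1) := fun n => by positivity
  choose K q hq hqk using fun n : ℕ => exists_lipschitzWith_near_projIcc hab hf (hpos n)
  choose u hu using fun n => exists_solvesMildEq_of_lipschitz hT (hq n) z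
  have hb := barrierConst_pos d 1
  set c := 4 * barrierConst d 1 * Real.exp ((|(|κ|)| + 1 + 1 / 2) * T) with hc
  have hanti : ∀ {m n : ℕ}, m ≤ n → 1 / ((n : ℝ) + 1) ≤ 1 / ((m : ℝ) + 1) := fun h =>
    one_div_le_one_div_of_le (by positivity) (by exact_mod_cast Nat.succ_le_succ h)
  have hcau : CauchySeq u := by
    refine cauchySeq_of_le_tendsto_0 (fun N => c * (1 / ((N : ℝ) + 1))) (fun m n N hm hn => ?_) ?_
    · refine (BoundedContinuousFunction.dist_le (by positivity)).2 fun p => ?_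
      have := (hu m).abs_sub_le_of_near hT (hpos N) (f := k) (hq m).continuous (hq n).continuous
        (fun _ _ h => projIcc_one_sided hab hκ h)
        (fun r => (hqk m r).trans (hanti hm)) (fun r => (hqk n r).trans (hanti hn)) (hu n) p.1 p.2
      refine this.trans_eq ?_
      rw [hc]; ring
    · simpa using tendsto_one_div_add_atTop_nhds_zero_nat.const_mul c
  obtain ⟨v, hv⟩ := cauchySeq_tendsto_of_complete hcau
  refine ⟨v, (solvesMildEq_iff hT).2 fun t x => ?_⟩
  have hlim1 : Tendsto (fun n => u n (t, x)) atTop (𝓝 (v (t, x))) :=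
    ((BoundedContinuousFunction.evalCLM ℝ (t, x)).continuous.tendsto v).comp hv
  obtain ⟨B, hB⟩ := exists_bound_mildSource hT hkc.continuous v
  have hlim2 : Tendsto (fun n => duhamel (mildSource hT (q n) (u n)) t x) atTop
      (𝓝 (duhamel (mildSource hT k v) t x)) := by
    rw [Metric.tendsto_atTop']
    intro ε hε
    -- One $\varepsilon'$ for $q_n$ against $k$, one for the uniform continuity of $k$; $T+1$ keeps
    -- the final inequality strict.
    set ε' := ε / (2 * (T + 1)) with hε'
    have hε'0 : 0 < ε' := by positivity
    obtain ⟨δ, hδ, hkδ⟩ := Metric.uniformContinuous_iff.1 hkc ε' hε'0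
    have ev1 : ∀ᶠ n : ℕ in atTop, 1 / ((n : ℝ) + 1) < ε' :=
      tendsto_one_div_add_atTop_nhds_zero_nat.eventually (gt_mem_nhds hε'0)
    have ev2 : ∀ᶠ n in atTop, dist (u n) v < δ := hv.eventually (Metric.ball_mem_nhds v hδ)
    obtain ⟨N, hN⟩ := eventually_atTop.1 (ev1.and ev2)
    refine ⟨N, fun n hn => ?_⟩
    obtain ⟨h1, h2⟩ := hN n hn.le
    obtain ⟨B', hB'⟩ := exists_bound_mildSource hT (hq n).continuous (u n)
    rw [Real.dist_eq, ← duhamel_sub (continuous_mildSource hT (hq n).continuous (u n))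
      (continuous_mildSource hT hkc.continuous v) hB' hB]
    have h := abs_duhamel_le
      (g := fun s y => mildSource hT (q n) (u n) s y - mildSource hT k v s y)
      (b := fun _ => 2 * ε') t.2.1 continuous_const (fun s _ y => ?_) x
    · refine h.trans_lt ?_
      simp only [intervalIntegral.integral_const, sub_zero, smul_eq_mul]
      have h3 : (t : ℝ) ≤ T := t.2.2
      calc (t : ℝ) * (2 * ε') ≤ T * (2 * ε') := by gcongr
        _ < (T + 1) * (2 * ε') := by gcongr; linarith
        _ = ε := by rw [hε']; field_simp
    · have h3 := hqk n (u n (projIcc 0 T hT s, y))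
      have h4 := hkδ (((u n).dist_coe_le_dist (g := v) (projIcc 0 T hT s, y)).trans_lt h2)
      rw [Real.dist_eq] at h4
      have h5 := abs_sub_le (q n (u n (projIcc 0 T hT s, y))) (k (u n (projIcc 0 T hT s, y)))
        (k (v (projIcc 0 T hT s, y)))
      refine h5.trans ?_
      linarith
  refine tendsto_nhds_unique hlim1 ((hlim2.add_const (z (t, x))).congr fun n => ?_)
  exact ((solvesMildEq_iff hT).1 (hu n) t x).symm

lemma exists_solvesMildEq {d : ℕ} {T κ : ℝ} (hT : 0 ≤ T) {f : ℝ → ℝ}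
    (hf : Continuous f) (hκ : ∀ u₁ u₂ : ℝ, u₁ < u₂ → f u₂ - f u₁ ≤ κ * (u₂ - u₁))
    (z : Cb T d) : ∃ u, SolvesMildEq f z u := by
  have hb := barrierConst_pos d 1
  -- This is the a priori bound for the truncated equation. It does not depend on the truncation
  -- level, since truncation at any $R\ge0$ keeps $f(0)$ and the one-sided constant $|\kappa|$.
  set R : ℝ := ((1 + ‖z‖) * barrierConst d 1 *
      Real.exp ((2 * |(|κ|)| + |(|f 0|)| + 1 + 1 / 2) * T) + ‖z‖) with hR
  have hR0 : 0 ≤ R := by positivity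
  have hab : -R ≤ R := by linarith
  have hproj : ∀ r ∈ Icc (-R) R, (projIcc (-R) R hab r : ℝ) = r := fun r hr => by
    rw [projIcc_of_mem hab hr]
  obtain ⟨u, hu⟩ := exists_solvesMildEq_projIcc hT hab hf hκ z
  have hbound : ∀ t x, u (t, x) ∈ Icc (-R) R := fun t x => by
    have := hu.abs_le_polyWeight (θ := 1) (F := |f 0|) zero_lt_one hT
      (hf.comp (continuous_subtype_val.comp continuous_projIcc))
      (fun _ _ h => projIcc_one_sided hab hκ h)
      (by simp only [Function.comp_apply, hproj 0 ⟨by linarith, hR0⟩, le_refl]) x (norm_nonneg z)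
      (fun s y => (z.norm_coe_le_norm (s, y)).trans
        (le_mul_of_one_le_right (norm_nonneg z) (one_le_polyWeight 1 x y))) t x
    rw [← hR] at this
    exact abs_le.1 (by simpa [polyWeight] using this)
  refine ⟨u, fun t x => ?_⟩
  have h := hu t x
  simp only [hproj _ (hbound _ _)] at h
  exact h

/-! ### The weighted norm and the conclusion. -/

lemma abs_le_weightedSupNorm_mul {d : ℕ} {T : ℝ} (θ : ℝ) (x₀ : EuclideanSpace ℝ (Fin d))
    (z : Cb T d) (t : Icc (0 : ℝ) T) (x : EuclideanSpace ℝ (Fin d)) :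
    |z (t, x)| ≤ weightedSupNorm θ x₀ z * polyWeight θ x₀ x := by
  have hle : ∀ s y, |z (s, y)| / (1 + ‖y - x₀‖ ^ θ) ≤ ‖z‖ := fun s y => by
    refine (div_le_self (abs_nonneg _) (one_le_polyWeight θ x₀ y)).trans (z.norm_coe_le_norm _)
  have h1 : |z (t, x)| / (1 + ‖x - x₀‖ ^ θ) ≤ ⨆ y, |z (t, y)| / (1 + ‖y - x₀‖ ^ θ) :=
    le_ciSup (f := fun y => |z (t, y)| / (1 + ‖y - x₀‖ ^ θ))
      ⟨‖z‖, by rintro _ ⟨y, rfl⟩; exact hle t y⟩ x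
  have h2 : ⨆ y, |z (t, y)| / (1 + ‖y - x₀‖ ^ θ) ≤ weightedSupNorm θ x₀ z :=
    le_ciSup (f := fun s => ⨆ y, |z (s, y)| / (1 + ‖y - x₀‖ ^ θ))
      ⟨‖z‖, by rintro _ ⟨s, rfl⟩; exact ciSup_le (hle s)⟩ t
  have h3 := one_le_polyWeight θ x₀ x
  rw [← div_le_iff₀ (by linarith)]
  exact h1.trans h2

lemma weightedSupNorm_nonneg {d : ℕ} {T : ℝ} (θ : ℝ) (x₀ : EuclideanSpace ℝ (Fin d))
    (z : Cb T d) : 0 ≤ weightedSupNorm θ x₀ z :=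
  Real.iSup_nonneg fun _ => Real.iSup_nonneg fun _ => by positivity

theorem corollary5 (d : ℕ) (θ κ F : ℝ) (hθ : 0 < θ) :
    ∃ C : ℝ, 0 < C ∧
      ∀ f : ℝ → ℝ, Continuous f →
        (∀ u₁ u₂ : ℝ, u₁ < u₂ → f u₂ - f u₁ ≤ κ * (u₂ - u₁)) →
        |f 0| ≤ F →
        ∀ T : ℝ, 0 < T → ∀ z : Cb T d,
          (∃! u : Cb T d, SolvesMildEq f z u) ∧
          ∀ u : Cb T d, SolvesMildEq f z u →
            ∀ x₀ : EuclideanSpace ℝ (Fin d),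
              weightedSupNorm θ x₀ u ≤
                C * Real.exp (C * T) * (1 + weightedSupNorm θ x₀ z) := by
  have hb := barrierConst_pos d θ
  set l : ℝ := 2 * |κ| + |F| + 1 + θ / 2 with hl
  have hl0 : 0 ≤ l := by positivity
  -- `barrierConst d θ` is the prefactor, $1$ absorbs the extra $N$, and $l$ is the exponential
  -- rate; the sum serves in both places.
  refine ⟨barrierConst d θ + 1 + l, by positivity, fun f hf hκ hF T hT z => ⟨?_, ?_⟩⟩
  · obtain ⟨u, hu⟩ := exists_solvesMildEq hT.le hf hκ z
    exact ⟨u, hu, fun v hv => hv.unique hT.le hf hκ hu⟩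
  · intro u hu x₀
    have hN := weightedSupNorm_nonneg θ x₀ z
    set N := weightedSupNorm θ x₀ z
    have : Nonempty (Icc (0 : ℝ) T) := ⟨⟨0, le_rfl, hT.le⟩⟩
    refine ciSup_le fun t => ciSup_le fun x => ?_
    have h3 := one_le_polyWeight θ x₀ x
    have h := hu.abs_le_polyWeight hθ hT.le hf hκ hF x₀ hN (abs_le_weightedSupNorm_mul θ x₀ z) t x
    rw [← hl] at h
    have hp : 0 < 1 + ‖x - x₀‖ ^ θ := by positivity
    rw [div_le_iff₀ hp]
    refine h.trans (mul_le_mul_of_nonneg_right ?_ hp.le)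
    have hE : Real.exp (l * T) ≤ Real.exp ((barrierConst d θ + 1 + l) * T) := by
      gcongr; linarith
    have hE1 : 1 ≤ Real.exp ((barrierConst d θ + 1 + l) * T) :=
      Real.one_le_exp (by positivity)
    set E := Real.exp ((barrierConst d θ + 1 + l) * T)
    calc (1 + N) * barrierConst d θ * Real.exp (l * T) + N
        ≤ (1 + N) * barrierConst d θ * E + (1 + N) * E := by
          gcongr
          nlinarith
      _ ≤ (1 + N) * barrierConst d θ * E + (1 + N) * E + l * E * (1 + N) := by
          have : 0 ≤ l * E * (1 + N) := by positivity
          linarith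
      _ = (barrierConst d θ + 1 + l) * E * (1 + N) := by ring
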